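/- Let $f:\mathbb{C}\to\mathbb{C}$ be a transcendental entire function, that is, an entire function that is not a polynomial. Write $f^n$ for the $n$-th iterate of $f$, let $M(r,f)=\max_{|z|=r}|f(z)|$ for $r\ge 0$, and let $M^n(r,f)$ be the $n$-th iterate of $r\mapsto M(r,f)$. Let $$A(f)=\{z\in\mathbb{C}: \text{there is } \ell\in\mathbb{N} \text{ such that } |f^{n+\ell}(z)|\ge M^n(R,f) \text{ for all } n\in\mathbb{N}\}$$ be the fast escaping set of $f$, where $R>0$ is any number with $M^n(R,f)\to\infty$ as $n\to\infty$ (the set does not depend on the choice of $R$), and let $$A'(f)=\{z\in A(f): \text{there is } N\in\mathbb{N} \text{ such that } |f^n(z)|=M(|f^{n-1}(z)|,f) \text{ for all } n\ge N\}$$ be the maximally fast escaping set; here $\mathbb{N}=\{1,2,\dots\}$. Let $\mathcal{M}(f)=\{z: |f(z)|=M(|z|,f)\}$. Then $A'(f)$ is contained in a countable union of curves, each of which is analytic except possibly at its endpoints; that is, each is the image of a continuous injective map $\gamma:[0,1]\to\mathbb{C}$ that is real analytic with $\gamma'\neq 0$ on $(0,1)$. Moreover, with $f^{-k}(S)$ denoting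 the preimage of $S$ under $f^k$ and $f^0$ the identity, $$A'(f)\subset\bigcup_{k=0}^{\infty} f^{-k}(\mathcal{M}(f)).$$ -/

import Mathlib

/-- `f` is an entire function that is not a polynomial. -/
def IsTranscendentalEntire (f : ℂ → ℂ) : Prop :=
  Differentiable ℂ f ∧ ¬ ∃ p : Polynomial ℂ, ∀ z, f z = p.eval z

/-- The maximum modulus `M(r, f)`, the maximum of `|f z|` over the circle `|z| = r`, for `r ≥ 0`.
The supremum is attained for continuous `f`, the circle being compact and nonempty. -/
noncomputable def maxModulus (f : ℂ → ℂ) (r : ℝ) : ℝ :=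
  sSup ((fun z : ℂ => ‖f z‖) '' Metric.sphere (0 : ℂ) r)

/-- The set of points where `f` attains its maximum modulus. -/
def maxModulusSet (f : ℂ → ℂ) : Set ℂ :=
  {z | ‖f z‖ = maxModulus f ‖z‖}

/-- The fast escaping set `A(f)`. The threshold `R > 0` is any number whose iterates under
`r ↦ M(r, f)` tend to infinity; for a transcendental entire function the set defined by one such
`R` does not depend on `R`, so it agrees with the union over all `R` taken here. -/
def fastEscapingSet (f : ℂ → ℂ) : Set ℂ :=
  {z | ∃ R : ℝ, 0 < R ∧
    Filter.Tendsto (fun n : ℕ => (maxModulus f)^[n] R) Filter.atTop Filter.atTop ∧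
    ∃ l : ℕ, 1 ≤ l ∧ ∀ n : ℕ, 1 ≤ n → (maxModulus f)^[n] R ≤ ‖f^[n + l] z‖}

/-- The maximally fast escaping set `A'(f)`. -/
def maximallyFastEscapingSet (f : ℂ → ℂ) : Set ℂ :=
  {z | z ∈ fastEscapingSet f ∧
    ∃ N : ℕ, 1 ≤ N ∧ ∀ n : ℕ, N ≤ n → ‖f^[n] z‖ = maxModulus f ‖f^[n - 1] z‖}

/-- `C` is a simple curve in the plane that is analytic except possibly at its endpoints: the image
of an injective continuous map on `[0, 1]` that is real analytic with nonvanishing derivative on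
`(0, 1)`. -/
def IsCurveAnalyticOffEndpoints (C : Set ℂ) : Prop :=
  ∃ γ : ℝ → ℂ, ContinuousOn γ (Set.Icc 0 1) ∧ Set.InjOn γ (Set.Icc 0 1) ∧
    AnalyticOnNhd ℝ γ (Set.Ioo 0 1) ∧ (∀ t ∈ Set.Ioo (0 : ℝ) 1, deriv γ t ≠ 0) ∧
    C = γ '' Set.Icc 0 1

/-!
If `f` attains its maximum modulus at `z`, then rotating `z` about the origin shows that
`z f'(z) / f(z)` is real. So `f^{-k}(M(f))` lies, apart from the countable set `Z` where `f^{k+1}`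
vanishes, in the set where `(z f' / f) ∘ f^k` is real. This function is holomorphic on the connected
open set `ℂ \ Z`, and it is nonconstant there: the Euler equation `z f' = c f` has only monomials
as entire solutions. Finally, the set where a nonconstant holomorphic function is real consists of
countably many critical points and, by the inverse function theorem, of a set which is locally an
analytic arc.
-/

open Filter Topology

theorem isCurveAnalyticOffEndpoints_segment {a b : ℂ} (hab : a ≠ b) :
    IsCurveAnalyticOffEndpoints (segment ℝ a b) := by
  refine ⟨AffineMap.lineMap a b, AffineMap.lineMap_continuous.continuousOn,
    (AffineMap.lineMap_injective ℝ hab).injOn, fun t _ => ?_, fun t _ => ?_,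
    segment_eq_image_lineMap ℝ a b⟩
  · have : (AffineMap.lineMap a b : ℝ → ℂ) = fun t => t • (b - a) + a :=
      funext fun t => AffineMap.lineMap_apply_module' a b t
    rw [this]
    fun_prop
  · rw [AffineMap.hasDerivAt_lineMap.deriv]
    exact sub_ne_zero.2 hab.symm

theorem IsCurveAnalyticOffEndpoints.image {C : Set ℂ} (hC : IsCurveAnalyticOffEndpoints C)
    {φ : ℂ → ℂ} (hφ : AnalyticOnNhd ℂ φ C) (hinj : Set.InjOn φ C)
    (hderiv : ∀ z ∈ C, deriv φ z ≠ 0) : IsCurveAnalyticOffEndpoints (φ '' C) := by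
  obtain ⟨γ, hγc, hγinj, hγa, hγd, rfl⟩ := hC
  have hmaps : Set.MapsTo γ (Set.Icc 0 1) (γ '' Set.Icc 0 1) := Set.mapsTo_image _ _
  have hmem : ∀ t ∈ Set.Ioo (0 : ℝ) 1, γ t ∈ γ '' Set.Icc 0 1 := fun t ht =>
    hmaps (Set.Ioo_subset_Icc_self ht)
  refine ⟨φ ∘ γ, hφ.continuousOn.comp hγc hmaps, hinj.comp hγinj hmaps,
    fun t ht => (hφ _ (hmem t ht)).restrictScalars.comp (hγa t ht), fun t ht => ?_,
    (Set.image_comp φ γ _).symm⟩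
  have hcomp := (hφ _ (hmem t ht)).differentiableAt.hasDerivAt.comp t
    (hγa t ht).differentiableAt.hasDerivAt
  rw [hcomp.deriv]
  exact mul_ne_zero (hderiv _ (hmem t ht)) (hγd t ht)

theorem isCurveAnalyticOffEndpoints_ofReal_image_Icc {a b : ℝ} (hab : a < b) :
    IsCurveAnalyticOffEndpoints (Complex.ofReal '' Set.Icc a b) := by
  have hseg : Complex.ofReal '' segment ℝ a b = segment ℝ (a : ℂ) b :=
    image_segment ℝ Complex.ofRealCLM.toLinearMap.toAffineMap a b
  rw [← segment_eq_Icc hab.le, hseg]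
  exact isCurveAnalyticOffEndpoints_segment (Complex.ofReal_injective.ne hab.ne)

theorem exists_analyticOnNhd_leftInvOn_ball {𝕜 : Type*} [NontriviallyNormedField 𝕜]
    [CompleteSpace 𝕜] [CharZero 𝕜] {g : 𝕜 → 𝕜} {z : 𝕜} (hg : AnalyticAt 𝕜 g z)
    (hg' : deriv g z ≠ 0) :
    ∃ φ : 𝕜 → 𝕜, (∀ᶠ w in 𝓝 z, φ (g w) = w) ∧ ∃ r > 0,
      AnalyticOnNhd 𝕜 φ (Metric.ball (g z) r) ∧ Set.LeftInvOn g φ (Metric.ball (g z) r) ∧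
        ∀ y ∈ Metric.ball (g z) r, deriv φ y ≠ 0 := by
  have hstrict := hg.hasStrictDerivAt
  have hφ := hg.analyticAt_localInverse hg'
  have hφ' : deriv (hstrict.localInverse _ _ _ hg') (g z) ≠ 0 := by
    rw [(hstrict.to_localInverse hg').hasDerivAt.deriv]
    exact inv_ne_zero hg'
  obtain ⟨r, hr, hball⟩ := Metric.eventually_nhds_iff_ball.1 <|
    hφ.eventually_analyticAt.and <| (hstrict.eventually_right_inverse hg').and <|
      hφ.deriv.continuousAt.eventually_ne hφ'
  exact ⟨_, hstrict.eventually_left_inverse hg', r, hr, fun y hy => (hball y hy).1,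
    fun y hy => (hball y hy).2.1, fun y hy => (hball y hy).2.2⟩

theorem exists_isCurveAnalyticOffEndpoints_of_im_eq_zero {g : ℂ → ℂ} {z : ℂ}
    (hg : AnalyticAt ℂ g z) (hg' : deriv g z ≠ 0) (hz : (g z).im = 0) :
    ∃ C, IsCurveAnalyticOffEndpoints C ∧ ∀ᶠ w in 𝓝 z, (g w).im = 0 → w ∈ C := by
  have hreal : ∀ w, (g w).im = 0 → g w = (g w).re := fun w hw => Complex.ext rfl hw
  obtain ⟨φ, hleft, r, hr, hφ, hright, hφ'⟩ := exists_analyticOnNhd_leftInvOn_ball hg hg'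
  set S : Set ℂ := Complex.ofReal '' Metric.closedBall (g z).re (r / 2)
  have hS : S ⊆ Metric.ball (g z) r := by
    rintro _ ⟨t, ht, rfl⟩
    rw [hreal z hz, Metric.mem_ball, Complex.isometry_ofReal.dist_eq]
    exact (Metric.mem_closedBall.1 ht).trans_lt (half_lt_self hr)
  have hScurve : IsCurveAnalyticOffEndpoints S := by
    simp only [S, Real.closedBall_eq_Icc]
    exact isCurveAnalyticOffEndpoints_ofReal_image_Icc (by linarith)
  refine ⟨φ '' S, hScurve.image (hφ.mono hS) (hright.injOn.mono hS) fun y hy => hφ' y (hS hy), ?_⟩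
  filter_upwards [hleft, hg.continuousAt (Metric.closedBall_mem_nhds _ (half_pos hr))]
    with w hw hwball hwim
  rw [Set.mem_preimage, hreal z hz, hreal w hwim, Metric.mem_closedBall,
    Complex.isometry_ofReal.dist_eq] at hwball
  exact ⟨g w, ⟨(g w).re, hwball, (hreal w hwim).symm⟩, hw⟩

/-- The set `S` is contained in a countable union of curves that are analytic except possibly at
their endpoints; this is the smallness asserted of `A'(f)`. -/
def CoveredByCurves (S : Set ℂ) : Prop :=
  ∃ 𝒞 : Set (Set ℂ), 𝒞.Countable ∧ (∀ C ∈ 𝒞, IsCurveAnalyticOffEndpoints C) ∧ S ⊆ ⋃₀ 𝒞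

namespace CoveredByCurves

theorem mono {S T : Set ℂ} (hT : CoveredByCurves T) (h : S ⊆ T) : CoveredByCurves S := by
  obtain ⟨𝒞, hcount, hcurve, hT⟩ := hT
  exact ⟨𝒞, hcount, hcurve, h.trans hT⟩

theorem iUnion {ι : Type*} [Countable ι] {S : ι → Set ℂ} (hS : ∀ i, CoveredByCurves (S i)) :
    CoveredByCurves (⋃ i, S i) := by
  choose 𝒞 hcount hcurve hS using hS
  refine ⟨⋃ i, 𝒞 i, Set.countable_iUnion hcount, fun C hC => ?_,
    Set.iUnion_subset fun i => (hS i).trans (Set.sUnion_mono (Set.subset_iUnion 𝒞 i))⟩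
  obtain ⟨i, hi⟩ := Set.mem_iUnion.1 hC
  exact hcurve i C hi

theorem union {S T : Set ℂ} (hS : CoveredByCurves S) (hT : CoveredByCurves T) :
    CoveredByCurves (S ∪ T) := by
  rw [Set.union_eq_iUnion]
  exact iUnion (Bool.forall_bool.2 ⟨hT, hS⟩)

theorem of_countable {S : Set ℂ} (hS : S.Countable) : CoveredByCurves S := by
  refine ⟨(fun z => segment ℝ z (z + 1)) '' S, hS.image _, ?_,
    fun z hz => ⟨_, Set.mem_image_of_mem _ hz, left_mem_segment ℝ z (z + 1)⟩⟩
  rintro _ ⟨z, _, rfl⟩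
  exact isCurveAnalyticOffEndpoints_segment (by simp)

theorem of_locally {S : Set ℂ} (h : ∀ z ∈ S, ∃ C, IsCurveAnalyticOffEndpoints C ∧ C ∈ 𝓝[S] z) :
    CoveredByCurves S := by
  choose! C hcurve hC using h
  obtain ⟨t, htS, ht, hcover⟩ := TopologicalSpace.countable_cover_nhdsWithin hC
  exact ⟨C '' t, ht.image C, Set.forall_mem_image.2 fun z hz => hcurve z (htS hz),
    by rwa [Set.sUnion_image]⟩

end CoveredByCurves

theorem countable_inter_preimage_zero {𝕜 E : Type*} [NontriviallyNormedField 𝕜]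
    [SecondCountableTopology 𝕜] [NormedAddCommGroup E] [NormedSpace 𝕜 E] {g : 𝕜 → E} {U : Set 𝕜}
    (hg : AnalyticOnNhd 𝕜 g U) (hU : IsPreconnected U) (hne : ∃ a ∈ U, g a ≠ 0) :
    (U ∩ g ⁻¹' {0}).Countable := by
  obtain ⟨a, haU, ha⟩ := hne
  have hcodisc := hg.preimage_zero_mem_codiscreteWithin ha haU ⟨⟨a, haU⟩, hU⟩
  rw [Set.preimage_compl] at hcodisc
  rw [Set.inter_comm]
  exact (HereditarilyLindelofSpace.isLindelof _).countable_of_isDiscrete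
    (isDiscrete_of_codiscreteWithin hcodisc)

theorem coveredByCurves_setOf_im_eq_zero {g : ℂ → ℂ} {U : Set ℂ} (hU : IsOpen U)
    (hUconn : IsPreconnected U) (hg : DifferentiableOn ℂ g U) (hne : (g '' U).Nontrivial) :
    CoveredByCurves {z ∈ U | (g z).im = 0} := by
  have hga : AnalyticOnNhd ℂ g U := hg.analyticOnNhd hU
  have hderiv : ∃ a ∈ U, deriv g a ≠ 0 := by
    by_contra! h
    obtain ⟨_, ⟨a, ha, rfl⟩, _, ⟨b, hb, rfl⟩, hab⟩ := hne
    exact hab (hU.is_const_of_deriv_eq_zero hUconn hg h ha hb)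
  have hcrit : CoveredByCurves (U ∩ deriv g ⁻¹' {0}) :=
    .of_countable (countable_inter_preimage_zero hga.deriv hUconn hderiv)
  have hregular : CoveredByCurves {z ∈ U | (g z).im = 0 ∧ deriv g z ≠ 0} := by
    refine .of_locally fun z hz => ?_
    obtain ⟨C, hC, hcover⟩ :=
      exists_isCurveAnalyticOffEndpoints_of_im_eq_zero (hga z hz.1) hz.2.2 hz.2.1
    refine ⟨C, hC, mem_nhdsWithin_iff_eventually.2 ?_⟩
    filter_upwards [hcover] with w hw hwS using hw hwS.2.1
  refine (hcrit.union hregular).mono fun z hz => ?_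
  by_cases h : deriv g z = 0
  exacts [.inl ⟨hz.1, h⟩, .inr ⟨hz.1, hz.2, h⟩]

theorem countable_preimage_zero_of_differentiable {g : ℂ → ℂ} (hg : Differentiable ℂ g)
    (hne : ∃ a, g a ≠ 0) : (g ⁻¹' {0}).Countable := by
  simpa only [Set.univ_inter] using countable_inter_preimage_zero
    (fun z _ => hg.analyticAt z) isPreconnected_univ (hne.imp fun _ ha => ⟨trivial, ha⟩)

theorem countable_preimage_of_differentiable {g : ℂ → ℂ} (hg : Differentiable ℂ g)
    (hne : (Set.range g).Nontrivial) {S : Set ℂ} (hS : S.Countable) : (g ⁻¹' S).Countable := by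
  rw [← Set.biUnion_preimage_singleton]
  refine hS.biUnion fun c _ => ?_
  obtain ⟨_, ⟨a, rfl⟩, ha⟩ := hne.exists_ne c
  have hzeros := countable_preimage_zero_of_differentiable (hg.sub_const c) ⟨a, sub_ne_zero.2 ha⟩
  exact hzeros.mono fun z hz => sub_eq_zero.2 hz

theorem nontrivial_range_comp {f g : ℂ → ℂ} (hf : Differentiable ℂ f) (hg : Differentiable ℂ g)
    (hfne : (Set.range f).Nontrivial) (hgne : (Set.range g).Nontrivial) :
    (Set.range (f ∘ g)).Nontrivial := by
  by_contra h
  rw [Set.not_nontrivial_iff] at h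
  have hfiber : (g ⁻¹' (f ⁻¹' {f (g 0)})).Countable :=
    countable_preimage_of_differentiable hg hgne <|
      countable_preimage_of_differentiable hf hfne <| Set.countable_singleton _
  exact not_countable_complex <|
    hfiber.mono fun z _ => h (Set.mem_range_self z) (Set.mem_range_self 0)

theorem nontrivial_range_iterate {f : ℂ → ℂ} (hf : Differentiable ℂ f)
    (hne : (Set.range f).Nontrivial) (k : ℕ) : (Set.range f^[k]).Nontrivial := by
  induction k with
  | zero => simpa only [Function.iterate_zero, Set.range_id] using Set.nontrivial_univ
  | succ k ih =>
    rw [Function.iterate_succ']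
    exact nontrivial_range_comp hf (hf.iterate k) hne ih

theorem iteratedDeriv_id_mul_deriv_zero {𝕜 : Type*} [NontriviallyNormedField 𝕜] {f : 𝕜 → 𝕜}
    {n : ℕ} (hf : ContDiffAt 𝕜 n (deriv f) 0) :
    iteratedDeriv n (id * deriv f) 0 = n * iteratedDeriv n f 0 := by
  rw [iteratedDeriv_mul contDiffAt_id hf]
  cases n with
  | zero => simp
  | succ n =>
    rw [Finset.sum_eq_single 1]
    · simp [iteratedDeriv_id, iteratedDeriv_succ']
    · intro i _ hi
      simp +contextual [iteratedDeriv_id, hi]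
    · simp

theorem exists_eq_mul_pow_of_mul_deriv_eq {f : ℂ → ℂ} (hf : Differentiable ℂ f) {c : ℂ}
    (h : ∀ z, z * deriv f z = c * f z) : ∃ (a : ℂ) (n : ℕ), ∀ z, f z = a * z ^ n := by
  -- The `n`-th Taylor coefficients at `0` of the two sides of `h` are `n * aₙ` and `c * aₙ`.
  have hcoeff : ∀ n : ℕ, iteratedDeriv n f 0 ≠ 0 → c = n := fun n hn => by
    have heq : iteratedDeriv n (id * deriv f) 0 = c * iteratedDeriv n f 0 := by
      rw [show id * deriv f = fun z => c * f z from funext h, iteratedDeriv_const_mul_field]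
    rw [iteratedDeriv_id_mul_deriv_zero hf.deriv.contDiff.contDiffAt] at heq
    exact (mul_right_cancel₀ hn heq).symm
  have htaylor := Complex.hasSum_taylorSeries_of_entire hf 0
  by_cases hzero : ∀ n, iteratedDeriv n f 0 = 0
  · refine ⟨0, 0, fun z => ?_⟩
    have hsum := htaylor z
    simp only [hzero, smul_zero] at hsum
    rw [hsum.unique hasSum_zero, zero_mul]
  · push Not at hzero
    obtain ⟨m, hm⟩ := hzero
    refine ⟨(m.factorial : ℂ)⁻¹ * iteratedDeriv m f 0, m, fun z => ?_⟩
    have hother : ∀ n ≠ m, iteratedDeriv n f 0 = 0 := fun n hnm => by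
      by_contra hn
      exact hnm (Nat.cast_injective ((hcoeff n hn).symm.trans (hcoeff m hm)))
    rw [(htaylor z).unique (hasSum_single m fun n hnm => by simp [hother n hnm]), sub_zero,
      smul_eq_mul, smul_eq_mul, mul_assoc, mul_comm (z ^ m)]

theorem im_mul_logDeriv_eq_zero_of_isLocalMaxOn {f : ℂ → ℂ} {z : ℂ} (hf : DifferentiableAt ℂ f z)
    (hmax : IsLocalMaxOn (fun w => ‖f w‖) (Metric.sphere 0 ‖z‖) z) :
    (z * logDeriv f z).im = 0 := by
  by_cases hz : f z = 0
  · simp [logDeriv_apply, hz]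
  let rot : ℝ → ℂ := fun θ => z * Complex.exp (θ * Complex.I)
  have hrot0 : rot 0 = z := by simp [rot]
  have hrot : HasDerivAt rot (z * Complex.I) 0 := by
    have hexponent := (Complex.ofRealCLM.hasDerivAt (x := (0 : ℝ))).mul_const Complex.I
    simpa using hexponent.cexp.const_mul z
  have hcomp : HasDerivAt (f ∘ rot) (f z * (Complex.I * (z * logDeriv f z))) 0 := by
    refine (hf.hasDerivAt.comp_of_eq 0 hrot hrot0.symm).congr_deriv ?_
    rw [logDeriv_apply]
    field_simp
  have htendsto : Tendsto rot (𝓝 0) (𝓝[Metric.sphere 0 ‖z‖] z) :=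
    tendsto_nhdsWithin_iff.2 ⟨hrot0 ▸ hrot.continuousAt, .of_forall fun θ => by
      simp [rot, Complex.norm_exp_ofReal_mul_I]⟩
  have hlocalMax : IsLocalMax (fun θ => ‖(f ∘ rot) θ‖ ^ 2) 0 := by
    filter_upwards [htendsto.eventually hmax] with θ hθ
    simpa [hrot0] using pow_le_pow_left₀ (norm_nonneg _) hθ 2
  -- At `θ = 0`, `|f (z * exp (i * θ))| ^ 2` has derivative
  -- `-2 * |f z| ^ 2 * im (z * f' z / f z)`.
  have hcritical := hlocalMax.hasDerivAt_eq_zero hcomp.norm_sq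
  rw [Function.comp_apply, hrot0, Complex.inner, mul_right_comm, Complex.mul_conj,
    Complex.re_ofReal_mul, Complex.I_mul_re] at hcritical
  simpa [hz, -Complex.mul_im] using hcritical

theorem isMaxOn_norm_of_mem_maxModulusSet {f : ℂ → ℂ} {z : ℂ}
    (hf : ContinuousOn f (Metric.sphere 0 ‖z‖)) (hz : z ∈ maxModulusSet f) :
    IsMaxOn (fun w => ‖f w‖) (Metric.sphere 0 ‖z‖) z := by
  intro w hw
  have hbdd := (isCompact_sphere (0 : ℂ) ‖z‖).bddAbove_image hf.norm
  exact (le_csSup hbdd (Set.mem_image_of_mem _ hw)).trans_eq hz.symm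

theorem nontrivial_range_of_not_monomial {f : ℂ → ℂ}
    (hmonomial : ¬ ∃ (a : ℂ) (n : ℕ), ∀ z, f z = a * z ^ n) : (Set.range f).Nontrivial := by
  by_contra h
  rw [Set.not_nontrivial_iff] at h
  exact hmonomial ⟨f 0, 0, fun z => by
    rw [pow_zero, mul_one, h (Set.mem_range_self z) (Set.mem_range_self 0)]⟩

theorem countable_setOf_mul_deriv_eq {f : ℂ → ℂ} (hf : Differentiable ℂ f)
    (hmonomial : ¬ ∃ (a : ℂ) (n : ℕ), ∀ z, f z = a * z ^ n) (c : ℂ) :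
    {z | z * deriv f z = c * f z}.Countable := by
  have hdiff : Differentiable ℂ fun z => z * deriv f z - c * f z :=
    (differentiable_id.mul hf.deriv).sub (hf.const_mul c)
  have hne : ∃ z, z * deriv f z - c * f z ≠ 0 := by
    by_contra! h
    exact hmonomial (exists_eq_mul_pow_of_mul_deriv_eq hf fun z => sub_eq_zero.1 (h z))
  exact (countable_preimage_zero_of_differentiable hdiff hne).mono fun z hz => sub_eq_zero.2 hz

theorem nontrivial_image_mul_logDeriv {f : ℂ → ℂ} (hf : Differentiable ℂ f)
    (hmonomial : ¬ ∃ (a : ℂ) (n : ℕ), ∀ z, f z = a * z ^ n) {U : Set ℂ} (hU : ¬ U.Countable)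
    (hzero : ∀ z ∈ U, f z ≠ 0) : ((fun z => z * logDeriv f z) '' U).Nontrivial := by
  by_contra h
  rw [Set.not_nontrivial_iff] at h
  obtain ⟨a, ha⟩ : U.Nonempty := Set.nonempty_iff_ne_empty.2 fun hempty => hU (by simp [hempty])
  refine hU ((countable_setOf_mul_deriv_eq hf hmonomial (a * logDeriv f a)).mono fun z hz => ?_)
  have hconst : z * logDeriv f z = a * logDeriv f a :=
    h (Set.mem_image_of_mem _ hz) (Set.mem_image_of_mem _ ha)
  rw [Set.mem_ofPred_eq, ← hconst, logDeriv_apply, mul_assoc, div_mul_cancel₀ _ (hzero z hz)]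

theorem coveredByCurves_preimage_maxModulusSet {f F : ℂ → ℂ} (hf : Differentiable ℂ f)
    (hmonomial : ¬ ∃ (a : ℂ) (n : ℕ), ∀ z, f z = a * z ^ n) (hF : Differentiable ℂ F)
    (hFne : (Set.range F).Nontrivial) : CoveredByCurves (F ⁻¹' maxModulusSet f) := by
  let g : ℂ → ℂ := fun z => z * logDeriv f z
  set Z : Set ℂ := F ⁻¹' (f ⁻¹' {0})
  have hZ : Z.Countable := countable_preimage_of_differentiable hF hFne <|
    countable_preimage_of_differentiable hf (nontrivial_range_of_not_monomial hmonomial) <|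
      Set.countable_singleton 0
  have hopen : IsOpen Zᶜ := ((isClosed_singleton.preimage hf.continuous).preimage
    hF.continuous).isOpen_compl
  have hconn : IsPreconnected Zᶜ :=
    (hZ.isConnected_compl_of_one_lt_rank (by simp)).isPreconnected
  have himage : ¬ (F '' Zᶜ).Countable := fun h => not_countable_complex <|
    (hZ.union (countable_preimage_of_differentiable hF hFne h)).mono fun z _ =>
      (em (z ∈ Z)).imp_right (Set.mem_image_of_mem F)
  have hdiff : DifferentiableOn ℂ (g ∘ F) Zᶜ := fun z hz =>
    ((differentiableAt_id.mul ((hf.deriv _).div (hf _) hz)).comp z (hF z)).differentiableWithinAt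
  have hne : ((g ∘ F) '' Zᶜ).Nontrivial := by
    rw [Set.image_comp]
    exact nontrivial_image_mul_logDeriv hf hmonomial himage (Set.forall_mem_image.2 fun z hz => hz)
  refine ((CoveredByCurves.of_countable hZ).union
    (coveredByCurves_setOf_im_eq_zero hopen hconn hdiff hne)).mono fun z hz => ?_
  refine (em (z ∈ Z)).imp_right fun hzZ => ⟨hzZ, ?_⟩
  exact im_mul_logDeriv_eq_zero_of_isLocalMaxOn (hf _)
    (isMaxOn_norm_of_mem_maxModulusSet hf.continuous.continuousOn hz).localize

theorem maximallyFastEscapingSet_subset (f : ℂ → ℂ) :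
    maximallyFastEscapingSet f ⊆ ⋃ k : ℕ, f^[k] ⁻¹' maxModulusSet f := by
  rintro z ⟨-, N, hN, h⟩
  have hNth := h N le_rfl
  rw [← Nat.sub_add_cancel hN, Function.iterate_succ_apply', Nat.add_sub_cancel] at hNth
  exact Set.mem_iUnion.2 ⟨N - 1, hNth⟩

theorem theorem1p1_general {f : ℂ → ℂ} (hf : Differentiable ℂ f)
    (hmonomial : ¬ ∃ (a : ℂ) (n : ℕ), ∀ z, f z = a * z ^ n) :
    CoveredByCurves (⋃ k : ℕ, f^[k] ⁻¹' maxModulusSet f) :=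
  .iUnion fun k => coveredByCurves_preimage_maxModulusSet hf hmonomial (hf.iterate k)
    (nontrivial_range_iterate hf (nontrivial_range_of_not_monomial hmonomial) k)

theorem IsTranscendentalEntire.not_monomial {f : ℂ → ℂ} (hf : IsTranscendentalEntire f) :
    ¬ ∃ (a : ℂ) (n : ℕ), ∀ z, f z = a * z ^ n := fun ⟨a, n, h⟩ =>
  hf.2 ⟨.monomial n a, fun z => by rw [h, Polynomial.eval_monomial]⟩

theorem theorem1p1 (f : ℂ → ℂ) (hf : IsTranscendentalEntire f) :
    (∃ 𝒞 : Set (Set ℂ), 𝒞.Countable ∧ (∀ C ∈ 𝒞, IsCurveAnalyticOffEndpoints C) ∧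
      maximallyFastEscapingSet f ⊆ ⋃₀ 𝒞) ∧
    maximallyFastEscapingSet f ⊆ ⋃ k : ℕ, f^[k] ⁻¹' maxModulusSet f :=
  ⟨(theorem1p1_general hf.1 hf.not_monomial).mono (maximallyFastEscapingSet_subset f),
    maximallyFastEscapingSet_subset f⟩
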